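/- Let $n\ge 2$, $t_0<T$, and let $a_0,\dots,a_n$ be continuous real-valued functions on $[t_0,T]$. Consider $$y'+\sum_{k=0}^n a_k(t)\,y^k=0,\qquad t\in[t_0,T]. \tag{1.1}$$ A solution $y$ on $[t_0,T]$ is called closed if $y(t_0)=y(T)$. Write $x^+=\max\{x,0\}$. Let $$c\ \ge\ \max_{t\in[t_0,T]}\int_{t_0}^t \exp\Big\{\int_{t_0}^\tau a_1(s)\,ds\Big\}a_0(\tau)\,d\tau$$ and put $$\eta_c(t)=\exp\Big\{-\int_{t_0}^t a_1(\tau)\,d\tau\Big\}\Big[c-\int_{t_0}^t\exp\Big\{\int_{t_0}^\tau a_1(s)\,ds\Big\}a_0(\tau)\,d\tau\Big],\qquad t\in[t_0,T].$$ Consider the conditions - $(8^0)$ $a_2(t)>0$ for $t\in[t_0,T]$; - $(9^0)$ $\sum_{k=3}^n|a_k(t)|\,\eta_c^{k-2}(t)\le a_2(t)$ for $t\in[t_0,T]$; - $(10^0)$ $\int_{t_0}^t\exp\big\{\int_{t_0}^\tau\big[\sum_{k=2}^n a_k^+(s)\,\eta_c^{k-1}(s)+a_1(s)\big]ds\big\}\,a_0(\tau)\,d\tau\le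 0$ for $t\in[t_0,T]$; - $(11^0)$ $c\big(1-\exp\big\{\int_{t_0}^T a_1(\tau)\,d\tau\big\}\big)\le\int_{t_0}^T\exp\big\{\int_{t_0}^\tau a_1(s)\,ds\big\}a_0(\tau)\,d\tau$. **Theorem 5.4.** If $(8^0)$–$(11^0)$ hold, then (1.1) has a nonnegative closed solution on $[t_0,T]$. Moreover, explicit thresholds for a parameter $\lambda$ in $a_2$ are obtained as follows ($\eta_c$ and $(11^0)$ do not involve $a_2$). Let $p$ be continuous on $[t_0,T]$. 1. If $p>0$ on $[t_0,T]$ and $a_2=\lambda p$, then $(9^0)$ holds for every $\lambda\ge\lambda_0:=\max_{t\in[t_0,T]}\big\{\sum_{k=3}^n|a_k(t)|\eta_c^{k-2}(t)/p(t)\big\}$. Consequently, for every such $\lambda>0$ for which $(10^0)$ and $(11^0)$ hold, (1.1) has a nonnegative closed solution on $[t_0,T]$. 2. If $a_2=\lambda+p$, then $(9^0)$ holds for every $\lambda\ge\lambda_0:=\max_{t\in[t_0,T]}\big\{\sum_{k=3}^n|a_k(t)|\eta_c^{k-2}(t)-p(t)\big\}$. Consequently, for every such $\lambda$ for which $\lambda+p>0$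 on $[t_0,T]$ and $(10^0)$ and $(11^0)$ hold, (1.1) has a nonnegative closed solution on $[t_0,T]$. -/

import Mathlib

open Set

noncomputable section

namespace PolyODE

/-- `y` is a solution on `[t₀, T]` of `y' + ∑_{k=0}^n a_k(t) y^k = 0`
(one-sided derivatives at the two end points). -/
def IsSolution (n : ℕ) (a : ℕ → ℝ → ℝ) (t₀ T : ℝ) (y : ℝ → ℝ) : Prop :=
  ∀ t ∈ Icc t₀ T,
    HasDerivWithinAt y (-∑ k ∈ Finset.range (n + 1), a k t * y t ^ k) (Icc t₀ T) t

/-- A closed solution on `[t₀, T]`: a solution with `y(t₀) = y(T)`. -/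
def IsClosedSolution (n : ℕ) (a : ℕ → ℝ → ℝ) (t₀ T : ℝ) (y : ℝ → ℝ) : Prop :=
  IsSolution n a t₀ T y ∧ y t₀ = y T

/-- The equation has a nonnegative closed solution on `[t₀, T]`. -/
def HasNonnegClosedSolution (n : ℕ) (a : ℕ → ℝ → ℝ) (t₀ T : ℝ) : Prop :=
  ∃ y : ℝ → ℝ, IsClosedSolution n a t₀ T y ∧ ∀ t ∈ Icc t₀ T, 0 ≤ y t

/-- `∫_{t₀}^t exp(∫_{t₀}^τ a₁(s) ds) a₀(τ) dτ`. -/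
def forcing (a : ℕ → ℝ → ℝ) (t₀ t : ℝ) : ℝ :=
  ∫ τ in t₀..t, Real.exp (∫ s in t₀..τ, a 1 s) * a 0 τ

/-- `η_c(t) = exp(-∫_{t₀}^t a₁) (c - ∫_{t₀}^t exp(∫_{t₀}^τ a₁) a₀(τ) dτ)`. -/
def eta (a : ℕ → ℝ → ℝ) (t₀ c t : ℝ) : ℝ :=
  Real.exp (-∫ τ in t₀..t, a 1 τ) * (c - forcing a t₀ t)

/-- `∑_{k=3}^n |a_k(t)| η_c(t)^{k-2}`; it depends on neither `a₂` nor the values of `a` above `n`. -/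
def higherSum (n : ℕ) (a : ℕ → ℝ → ℝ) (t₀ c t : ℝ) : ℝ :=
  ∑ k ∈ Finset.Icc 3 n, |a k t| * eta a t₀ c t ^ (k - 2)

/-- `∑_{k=3}^n |a_k(t)| η_c(t)^{k-2} ≤ a₂(t)` on `[t₀, T]`. -/
def DominationCond (n : ℕ) (a : ℕ → ℝ → ℝ) (t₀ T c : ℝ) : Prop :=
  ∀ t ∈ Icc t₀ T, higherSum n a t₀ c t ≤ a 2 t

/-- `∫_{t₀}^t exp(∫_{t₀}^τ [∑_{k=2}^n a_k⁺(s) η_c(s)^{k-1} + a₁(s)] ds) a₀(τ) dτ ≤ 0` on `[t₀, T]`,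
where `x⁺ = max x 0`. -/
def WeightedIntegralCond (n : ℕ) (a : ℕ → ℝ → ℝ) (t₀ T c : ℝ) : Prop :=
  ∀ t ∈ Icc t₀ T,
    ∫ τ in t₀..t,
      Real.exp (∫ s in t₀..τ,
        ((∑ k ∈ Finset.Icc 2 n, max (a k s) 0 * eta a t₀ c s ^ (k - 1)) + a 1 s)) * a 0 τ ≤ 0

/-- `c (1 - exp(∫_{t₀}^T a₁)) ≤ ∫_{t₀}^T exp(∫_{t₀}^τ a₁) a₀(τ) dτ`. -/
def EndpointCond (a : ℕ → ℝ → ℝ) (t₀ T c : ℝ) : Prop :=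
  c * (1 - Real.exp (∫ τ in t₀..T, a 1 τ)) ≤ forcing a t₀ T

/-- The coefficients `a` with `a₂` replaced by `q`. -/
def setSecond (a : ℕ → ℝ → ℝ) (q : ℝ → ℝ) : ℕ → ℝ → ℝ :=
  Function.update a 2 q

/-- The threshold `max_{t ∈ [t₀, T]} (∑_{k=3}^n |a_k(t)| η_c(t)^{k-2}) / p(t)` for `a₂ = λ p`. -/
def mulThreshold (n : ℕ) (a : ℕ → ℝ → ℝ) (t₀ T c : ℝ) (p : ℝ → ℝ) : ℝ :=
  sSup ((fun t => higherSum n a t₀ c t / p t) '' Icc t₀ T)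

/-- The threshold `max_{t ∈ [t₀, T]} (∑_{k=3}^n |a_k(t)| η_c(t)^{k-2} - p(t))` for `a₂ = λ + p`. -/
def addThreshold (n : ℕ) (a : ℕ → ℝ → ℝ) (t₀ T c : ℝ) (p : ℝ → ℝ) : ℝ :=
  sSup ((fun t => higherSum n a t₀ c t - p t) '' Icc t₀ T)

end PolyODE

end

namespace PolyODE

open Metric intervalIntegral

/-! The substitution `z = exp (∫ a₁) y` removes the linear term, and truncating `y` to `[0, η_c]`
makes the field bounded and Lipschitz, so solutions from `x ∈ [0, c]` live on all of `[t₀, T]` and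
depend continuously on `x` (`exists_truncated_flow`). The truncation is then shown to be inactive.
Above: domination makes the terms of degree at least two nonnegative on `[0, η_c]`
(`superlinear_nonneg`), so `z + forcing` decreases and `y ≤ η_c`. Below: these terms equal `h y`
with `h ≤ ∑ a_k⁺ η_c^{k-1}`, and the weighted integral condition keeps `z ≥ 0`
(`nonneg_of_weighted_integral_nonpos`). The endpoint condition says `η_c(T) ≤ c`, so `x ↦ y(T)` is a
continuous self-map of `[0, c]`; a fixed point gives the closed solution. -/

/-! ### Flows and primitives. -/

/-- A globally Lipschitz bounded vector field has a flow on `[t₀, T]`, continuous in the initial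
value. -/
theorem exists_flow_of_bounded_lipschitz {F : ℝ → ℝ → ℝ} {t₀ T K L c : ℝ} (hT : t₀ ≤ T)
    (hc : 0 ≤ c) (hK : 0 ≤ K) (hL : 0 ≤ L)
    (hcont : ∀ x, ContinuousOn (F · x) (Icc t₀ T))
    (hlip : ∀ t ∈ Icc t₀ T, ∀ x y, |F t x - F t y| ≤ K * |x - y|)
    (hbound : ∀ t ∈ Icc t₀ T, ∀ x, |F t x| ≤ L) :
    ∃ α : ℝ → ℝ → ℝ, (∀ x ∈ Icc 0 c, α x t₀ = x ∧
      ∀ t ∈ Icc t₀ T, HasDerivWithinAt (α x) (F t (α x t)) (Icc t₀ T) t) ∧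
      ContinuousOn (α · T) (Icc 0 c) := by
  have hsub : Icc 0 c ⊆ closedBall (0 : ℝ) c := fun x hx => by
    simpa [abs_of_nonneg hx.1] using hx.2
  have hr : 0 ≤ c + L * (T - t₀) := by
    have := sub_nonneg.2 hT
    positivity
  -- A solution starting in the ball of radius `c` moves at most `L * (T - t₀)`, so this larger
  -- radius lets Picard–Lindelöf cover the whole interval at once.
  have hPL : IsPicardLindelof F (tmin := t₀) (tmax := T) ⟨t₀, left_mem_Icc.2 hT⟩ (0 : ℝ)
      ⟨c + L * (T - t₀), hr⟩ ⟨c, hc⟩ ⟨L, hL⟩ ⟨K, hK⟩ :=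
    { lipschitzOnWith := fun t ht => LipschitzOnWith.of_dist_le_mul fun x _ y _ => hlip t ht x y
      continuousOn := fun x _ => hcont x
      norm_le := fun t ht x _ => hbound t ht x
      mul_max_le := by
        change L * max (T - t₀) (t₀ - t₀) ≤ c + L * (T - t₀) - c
        rw [sub_self, max_eq_left (sub_nonneg.2 hT)]
        linarith }
  obtain ⟨α, hα, L', hL'⟩ :=
    hPL.exists_forall_mem_closedBall_eq_hasDerivWithinAt_lipschitzOnWith
  exact ⟨α, fun x hx => hα x (hsub hx), ((hL' T (right_mem_Icc.2 hT)).continuousOn).mono hsub⟩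

theorem exists_abs_le_of_continuousOn {f : ℝ → ℝ} {t₀ T : ℝ} (hf : ContinuousOn f (Icc t₀ T)) :
    ∃ C, 0 ≤ C ∧ ∀ t ∈ Icc t₀ T, |f t| ≤ C := by
  obtain ⟨C, hC⟩ := isCompact_Icc.exists_bound_of_continuousOn hf
  exact ⟨max C 0, le_max_right _ _, fun t ht => (hC t ht).trans (le_max_left _ _)⟩

/-- A polynomial with continuous coefficients is Lipschitz on `[-M, M]`, uniformly in time. -/
theorem exists_lipschitz_sum_mul_pow {a : ℕ → ℝ → ℝ} (ha : ∀ k, Continuous (a k)) (t₀ T : ℝ)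
    {M : ℝ} (hM : 0 ≤ M) (S : Finset ℕ) :
    ∃ K, 0 ≤ K ∧ ∀ t ∈ Icc t₀ T, ∀ x y, |x| ≤ M → |y| ≤ M →
      |(∑ k ∈ S, a k t * x ^ k) - ∑ k ∈ S, a k t * y ^ k| ≤ K * |x - y| := by
  choose A hA0 hA using fun k =>
    exists_abs_le_of_continuousOn (t₀ := t₀) (T := T) (ha k).continuousOn
  refine ⟨∑ k ∈ S, A k * (k * M ^ (k - 1)),
    Finset.sum_nonneg fun k _ => mul_nonneg (hA0 k) (by positivity), ?_⟩
  intro t ht x y hx hy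
  rw [← Finset.sum_sub_distrib, Finset.sum_mul]
  refine (Finset.abs_sum_le_sum_abs _ _).trans (Finset.sum_le_sum fun k _ => ?_)
  rw [← mul_sub, abs_mul, mul_assoc]
  refine mul_le_mul (hA k t ht) ?_ (abs_nonneg _) (hA0 k)
  refine (abs_pow_sub_pow_le x y k).trans ?_
  have : max |x| |y| ^ (k - 1) ≤ M ^ (k - 1) :=
    pow_le_pow_left₀ (le_max_of_le_left (abs_nonneg _)) (max_le hx hy) _
  calc |x - y| * k * max |x| |y| ^ (k - 1) ≤ |x - y| * k * M ^ (k - 1) :=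
        mul_le_mul_of_nonneg_left this (by positivity)
    _ = k * M ^ (k - 1) * |x - y| := by ring

theorem hasDerivAt_integral {f : ℝ → ℝ} (hf : Continuous f) (t₀ t : ℝ) :
    HasDerivAt (fun u => ∫ s in t₀..u, f s) (f t) t :=
  integral_hasDerivAt_right (hf.intervalIntegrable _ _)
    hf.stronglyMeasurable.stronglyMeasurableAtFilter hf.continuousAt

theorem continuous_integral {f : ℝ → ℝ} (hf : Continuous f) (t₀ : ℝ) :
    Continuous fun u => ∫ s in t₀..u, f s :=
  continuous_iff_continuousAt.2 fun t => (hasDerivAt_integral hf t₀ t).continuousAt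

/-! ### Nonnegativity from a weighted integral. -/

/-- The sign principle behind nonnegativity: if `z' = -(e^{A} a₀ + h z)` with `h ≤ H` and the
integral of `a₀` weighted by `exp (∫ (H + a₁))` stays nonpositive, then `z` stays nonnegative. -/
theorem nonneg_of_weighted_integral_nonpos {z h H a₀ a₁ : ℝ → ℝ} {t₀ T : ℝ}
    (hh : Continuous h) (hH : Continuous H) (ha₀ : Continuous a₀) (ha₁ : Continuous a₁)
    (hz : ∀ t ∈ Icc t₀ T, HasDerivWithinAt z
      (-(Real.exp (∫ s in t₀..t, a₁ s) * a₀ t + h t * z t)) (Icc t₀ T) t)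
    (hz₀ : 0 ≤ z t₀) (hle : ∀ t ∈ Icc t₀ T, h t ≤ H t)
    (hW : ∀ t ∈ Icc t₀ T,
      ∫ τ in t₀..t, Real.exp (∫ s in t₀..τ, (H s + a₁ s)) * a₀ τ ≤ 0) :
    ∀ t ∈ Icc t₀ T, 0 ≤ z t := by
  set W : ℝ → ℝ := fun t => ∫ τ in t₀..t, Real.exp (∫ s in t₀..τ, (H s + a₁ s)) * a₀ τ with hWdef
  have hWd (t : ℝ) : HasDerivAt W (Real.exp (∫ s in t₀..t, (H s + a₁ s)) * a₀ t) t :=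
    hasDerivAt_integral (f := fun τ => Real.exp (∫ s in t₀..τ, (H s + a₁ s)) * a₀ τ)
      ((Real.continuous_exp.comp (continuous_integral (hH.add ha₁) t₀)).mul ha₀) t₀ t
  set p : ℝ → ℝ := fun t => Real.exp (∫ s in t₀..t, h s) with hp
  set φ : ℝ → ℝ := fun t => Real.exp (∫ s in t₀..t, (h s - H s)) with hφ
  have hpd (t : ℝ) : HasDerivAt p (p t * h t) t := (hasDerivAt_integral hh t₀ t).exp
  have hφd (t : ℝ) : HasDerivAt φ (φ t * (h t - H t)) t :=
    (hasDerivAt_integral (f := fun s => h s - H s) (hh.sub hH) t₀ t).exp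
  have hprod (t : ℝ) : p t * Real.exp (∫ s in t₀..t, a₁ s)
      = φ t * Real.exp (∫ s in t₀..t, (H s + a₁ s)) := by
    rw [hp, hφ, ← Real.exp_add, ← Real.exp_add, ← integral_add, ← integral_add]
    · congr 2
      ext s
      ring
    all_goals exact Continuous.intervalIntegrable (by fun_prop) _ _
  -- Adding `φ W` to `z p` cancels the `a₀` terms, whose sign is unknown; what remains is a product
  -- of the nonpositive factors `h - H` and `W`, times `φ > 0`.
  have hD (t : ℝ) (ht : t ∈ Icc t₀ T) :
      HasDerivWithinAt (fun t => z t * p t + φ t * W t) (φ t * (h t - H t) * W t)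
        (Icc t₀ T) t := by
    refine (((hz t ht).mul (hpd t).hasDerivWithinAt).add
      ((hφd t).mul (hWd t)).hasDerivWithinAt).congr_deriv ?_
    linear_combination (-a₀ t) * hprod t
  have hmono : MonotoneOn (fun t => z t * p t + φ t * W t) (Icc t₀ T) := by
    refine monotoneOn_of_hasDerivWithinAt_nonneg (convex_Icc _ _)
      (fun t ht => (hD t ht).continuousWithinAt)
      (fun t ht => (hD t (interior_subset ht)).mono interior_subset) fun t ht => ?_
    have ht' := interior_subset ht
    exact mul_nonneg_of_nonpos_of_nonpos
      (mul_nonpos_of_nonneg_of_nonpos (Real.exp_pos _).le (sub_nonpos.2 (hle t ht'))) (hW t ht')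
  intro t ht
  have h₀ : t₀ ∈ Icc t₀ T := left_mem_Icc.2 (ht.1.trans ht.2)
  have h1 := hmono h₀ ht ht.1
  have h2 : W t₀ = 0 := integral_same
  have h3 : p t₀ = 1 := by simp [hp]
  simp only [h2, h3, mul_one, mul_zero, add_zero] at h1
  have h4 : φ t * W t ≤ 0 := mul_nonpos_of_nonneg_of_nonpos (Real.exp_pos _).le (hW t ht)
  exact nonneg_of_mul_nonneg_left (by linarith) (Real.exp_pos (∫ s in t₀..t, h s))

/-! ### The truncated equation. -/

/-- The truncation of `y` to `[0, η_c(t)]`. -/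
noncomputable def clamp (a : ℕ → ℝ → ℝ) (t₀ c t y : ℝ) : ℝ := max 0 (min y (eta a t₀ c t))

/-- The terms of degree at least two, `∑_{k=2}^n a_k(t) x^k`. -/
noncomputable def superlinear (n : ℕ) (a : ℕ → ℝ → ℝ) (t x : ℝ) : ℝ := ∑ k ∈ Finset.Icc 2 n, a k t * x ^ k

theorem clamp_nonneg (a : ℕ → ℝ → ℝ) (t₀ c t y : ℝ) : 0 ≤ clamp a t₀ c t y := le_max_left _ _

theorem clamp_le_eta {a : ℕ → ℝ → ℝ} {t₀ c t : ℝ} (h : 0 ≤ eta a t₀ c t) (y : ℝ) :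
    clamp a t₀ c t y ≤ eta a t₀ c t := max_le h (min_le_right _ _)

theorem abs_clamp_sub_clamp_le (a : ℕ → ℝ → ℝ) (t₀ c t x y : ℝ) :
    |clamp a t₀ c t x - clamp a t₀ c t y| ≤ |x - y| := by
  refine (abs_max_sub_max_le_max _ _ _ _).trans (max_le (by simp) ?_)
  exact (abs_min_sub_min_le_max _ _ _ _).trans (max_le le_rfl (by simp))

theorem continuous_forcing {a : ℕ → ℝ → ℝ} (ha : ∀ k, Continuous (a k)) (t₀ : ℝ) :
    Continuous (forcing a t₀) :=
  continuous_integral ((Real.continuous_exp.comp (continuous_integral (ha 1) t₀)).mul (ha 0)) t₀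

theorem hasDerivAt_forcing {a : ℕ → ℝ → ℝ} (ha : ∀ k, Continuous (a k)) (t₀ t : ℝ) :
    HasDerivAt (forcing a t₀) (Real.exp (∫ s in t₀..t, a 1 s) * a 0 t) t :=
  hasDerivAt_integral
    ((Real.continuous_exp.comp (continuous_integral (ha 1) t₀)).mul (ha 0)) t₀ t

theorem continuous_eta {a : ℕ → ℝ → ℝ} (ha : ∀ k, Continuous (a k)) (t₀ c : ℝ) :
    Continuous (eta a t₀ c) :=
  (Real.continuous_exp.comp (continuous_integral (ha 1) t₀).neg).mul
    (continuous_const.sub (continuous_forcing ha t₀))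

/-- After factoring out `x ^ 2`, the terms with `k ≥ 3` contribute at least `-higherSum`, because `x
≤ η_c`; `a₂` absorbs this. -/
theorem superlinear_nonneg {n : ℕ} (hn : 2 ≤ n) {a : ℕ → ℝ → ℝ} {t₀ c t x : ℝ}
    (hdom : higherSum n a t₀ c t ≤ a 2 t) (hx : 0 ≤ x) (hxη : x ≤ eta a t₀ c t) :
    0 ≤ superlinear n a t x := by
  have h1 : superlinear n a t x
      = x ^ 2 * (a 2 t + ∑ k ∈ Finset.Icc 3 n, a k t * x ^ (k - 2)) := by
    rw [superlinear, ← Finset.insert_Icc_add_one_left_eq_Icc hn,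
      Finset.sum_insert (by simp), mul_add, Finset.mul_sum]
    refine congrArg₂ (· + ·) (mul_comm _ _) (Finset.sum_congr rfl fun k hk => ?_)
    have : x ^ k = x ^ 2 * x ^ (k - 2) := by
      rw [← pow_add]
      congr 1
      have := (Finset.mem_Icc.1 hk).1
      omega
    rw [this]
    ring
  rw [h1]
  refine mul_nonneg (sq_nonneg x) ?_
  have h2 : -higherSum n a t₀ c t ≤ ∑ k ∈ Finset.Icc 3 n, a k t * x ^ (k - 2) := by
    rw [higherSum, ← Finset.sum_neg_distrib]
    refine Finset.sum_le_sum fun k _ => ?_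
    have h3 : |a k t| * x ^ (k - 2) ≤ |a k t| * eta a t₀ c t ^ (k - 2) :=
      mul_le_mul_of_nonneg_left (pow_le_pow_left₀ hx hxη _) (abs_nonneg _)
    have h4 : -|a k t| * x ^ (k - 2) ≤ a k t * x ^ (k - 2) :=
      mul_le_mul_of_nonneg_right (neg_abs_le _) (pow_nonneg hx _)
    linarith
  linarith

theorem sum_eq_superlinear {n : ℕ} (hn : 2 ≤ n) (a : ℕ → ℝ → ℝ) (t x : ℝ) :
    ∑ k ∈ Finset.range (n + 1), a k t * x ^ k = a 0 t + a 1 t * x + superlinear n a t x := by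
  rw [superlinear, ← Finset.sum_range_add_sum_Ico _ (show 2 ≤ n + 1 by omega)]
  simp [Finset.sum_range_succ, Finset.Ico_add_one_right_eq_Icc]

/-- The truncated equation has a flow; here `z = exp (∫ a₁) y`. -/
theorem exists_truncated_flow {a : ℕ → ℝ → ℝ} (ha : ∀ k, Continuous (a k)) (n : ℕ) {t₀ T c : ℝ}
    (hT : t₀ ≤ T) (hc : 0 ≤ c) (hη : ∀ t ∈ Icc t₀ T, 0 ≤ eta a t₀ c t) :
    ∃ α : ℝ → ℝ → ℝ, (∀ x ∈ Icc 0 c, α x t₀ = x ∧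
      ∀ t ∈ Icc t₀ T, HasDerivWithinAt (α x)
        (-(Real.exp (∫ s in t₀..t, a 1 s) * (a 0 t + superlinear n a t
          (clamp a t₀ c t (Real.exp (-∫ s in t₀..t, a 1 s) * α x t))))) (Icc t₀ T) t) ∧
      ContinuousOn (α · T) (Icc 0 c) := by
  have hA := continuous_integral (ha 1) t₀
  have hηc := continuous_eta ha t₀ c
  obtain ⟨M, hM, hηM⟩ := exists_abs_le_of_continuousOn (t₀ := t₀) (T := T) hηc.continuousOn
  obtain ⟨B, hB, ha0⟩ := exists_abs_le_of_continuousOn (t₀ := t₀) (T := T) (ha 0).continuousOn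
  obtain ⟨C, hC, hEC⟩ := exists_abs_le_of_continuousOn (t₀ := t₀) (T := T)
    (f := fun t => Real.exp (∫ s in t₀..t, a 1 s)) (by fun_prop)
  obtain ⟨K, hK, hlip⟩ := exists_lipschitz_sum_mul_pow ha t₀ T hM (Finset.Icc 2 n)
  have hcl (t : ℝ) (ht : t ∈ Icc t₀ T) (y : ℝ) : |clamp a t₀ c t y| ≤ M := by
    rw [abs_of_nonneg (clamp_nonneg _ _ _ _ _)]
    exact (clamp_le_eta (hη t ht) y).trans ((le_abs_self _).trans (hηM t ht))
  refine exists_flow_of_bounded_lipschitz (K := K) (L := C * (B + K * M)) (F := fun t x =>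
      -(Real.exp (∫ s in t₀..t, a 1 s) * (a 0 t + superlinear n a t
        (clamp a t₀ c t (Real.exp (-∫ s in t₀..t, a 1 s) * x))))) hT hc hK
    (by positivity) (fun x => ?_) (fun t ht x y => ?_) fun t ht x => ?_
  · unfold superlinear clamp
    fun_prop
  -- The outer factor `exp e` and the inner `exp (-e)` cancel, so the polynomial's Lipschitz
  -- constant `K` survives unchanged.
  · set e := ∫ s in t₀..t, a 1 s
    have h1 := hlip t ht _ _ (hcl t ht (Real.exp (-e) * x)) (hcl t ht (Real.exp (-e) * y))
    have h2 := abs_clamp_sub_clamp_le a t₀ c t (Real.exp (-e) * x) (Real.exp (-e) * y)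
    rw [← mul_sub (Real.exp (-e)), abs_mul, abs_of_pos (Real.exp_pos (-e))] at h2
    have h3 := h1.trans (mul_le_mul_of_nonneg_left h2 hK)
    have h4 := mul_le_mul_of_nonneg_left h3 (Real.exp_pos e).le
    have h5 : Real.exp e * (K * (Real.exp (-e) * |x - y|)) = K * |x - y| := by
      rw [Real.exp_neg]
      field_simp
    rw [h5] at h4
    rw [neg_sub_neg, ← mul_sub, abs_mul, abs_of_pos (Real.exp_pos e), add_sub_add_left_eq_sub,
      abs_sub_comm]
    exact h4
  · rw [abs_neg, abs_mul]
    refine mul_le_mul (hEC t ht) ((abs_add_le _ _).trans (add_le_add (ha0 t ht) ?_))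
      (abs_nonneg _) hC
    have hcl' := hcl t ht (Real.exp (-∫ s in t₀..t, a 1 s) * x)
    -- All exponents are at least two, so the sum vanishes at `0` and its Lipschitz bound also
    -- bounds its size by `K * M`.
    have h1 := hlip t ht _ 0 hcl' (by simpa using hM)
    have h0 : ∑ k ∈ Finset.Icc 2 n, a k t * (0 : ℝ) ^ k = 0 :=
      Finset.sum_eq_zero fun k hk => by
        rw [zero_pow (by have := (Finset.mem_Icc.1 hk).1; omega), mul_zero]
    rw [h0, sub_zero, sub_zero] at h1
    exact h1.trans (mul_le_mul_of_nonneg_left hcl' hK)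

/-! ### A priori bounds and the period map. -/

/-- Existence of a nonnegative closed solution when the coefficients are continuous on `ℝ`. -/
theorem hasNonnegClosedSolution_of_continuous {n : ℕ} (hn : 2 ≤ n) {t₀ T : ℝ} (hT : t₀ < T)
    {a : ℕ → ℝ → ℝ} (ha : ∀ k, Continuous (a k)) {c : ℝ}
    (hc : ∀ t ∈ Icc t₀ T, forcing a t₀ t ≤ c)
    (hdom : DominationCond n a t₀ T c) (hweight : WeightedIntegralCond n a t₀ T c)
    (hend : EndpointCond a t₀ T c) : HasNonnegClosedSolution n a t₀ T := by
  have ht₀ : t₀ ∈ Icc t₀ T := left_mem_Icc.2 hT.le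
  have hTT : T ∈ Icc t₀ T := right_mem_Icc.2 hT.le
  have hF0 : forcing a t₀ t₀ = 0 := integral_same
  have hc0 : 0 ≤ c := hF0 ▸ hc t₀ ht₀
  have hη (t : ℝ) (ht : t ∈ Icc t₀ T) : 0 ≤ eta a t₀ c t :=
    mul_nonneg (Real.exp_pos _).le (sub_nonneg.2 (hc t ht))
  have hAd (t : ℝ) := hasDerivAt_integral (ha 1) t₀ t
  have hAc := continuous_integral (ha 1) t₀
  have hηc := continuous_eta ha t₀ c
  obtain ⟨α, hα, hαc⟩ := exists_truncated_flow ha n hT.le hc0 hη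
  set A : ℝ → ℝ := fun t => ∫ s in t₀..t, a 1 s with hAdef
  have hA0 : A t₀ = 0 := integral_same
  have hQ (t : ℝ) (ht : t ∈ Icc t₀ T) (y : ℝ) :
      0 ≤ superlinear n a t (clamp a t₀ c t y) :=
    superlinear_nonneg hn (hdom t ht) (clamp_nonneg _ _ _ _ _) (clamp_le_eta (hη t ht) y)
  have hup (x : ℝ) (hx : x ∈ Icc 0 c) (t : ℝ) (ht : t ∈ Icc t₀ T) :
      α x t ≤ c - forcing a t₀ t := by
    have hd (t : ℝ) (ht : t ∈ Icc t₀ T) :=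
      ((hα x hx).2 t ht).add (hasDerivAt_forcing ha t₀ t).hasDerivWithinAt
    have hanti : AntitoneOn (α x + forcing a t₀) (Icc t₀ T) := by
      refine antitoneOn_of_hasDerivWithinAt_nonpos (convex_Icc _ _)
        (fun t ht => (hd t ht).continuousWithinAt)
        (fun t ht => (hd t (interior_subset ht)).mono interior_subset) fun t ht => ?_
      have := mul_nonneg (Real.exp_pos (A t)).le
        (hQ t (interior_subset ht) (Real.exp (-A t) * α x t))
      linarith
    have := hanti ht₀ ht ht.1
    simp only [Pi.add_apply, (hα x hx).1, hF0] at this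
    linarith [hx.2]
  have hupη (x : ℝ) (hx : x ∈ Icc 0 c) (t : ℝ) (ht : t ∈ Icc t₀ T) :
      Real.exp (-A t) * α x t ≤ eta a t₀ c t :=
    mul_le_mul_of_nonneg_left (hup x hx t ht) (Real.exp_pos _).le
  have hlow (x : ℝ) (hx : x ∈ Icc 0 c) : ∀ t ∈ Icc t₀ T, 0 ≤ α x t := by
    -- `β` extends the truncated solution continuously beyond `[t₀, T]`
    set β : ℝ → ℝ := IccExtend hT.le ((Icc t₀ T).domRestrict (α x)) with hβ
    have hβc : Continuous β := by
      have : ContinuousOn (α x) (Icc t₀ T) := fun t ht => ((hα x hx).2 t ht).continuousWithinAt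
      exact (continuousOn_iff_continuous_domRestrict.1 this).Icc_extend'
    have hβeq (t : ℝ) (ht : t ∈ Icc t₀ T) : β t = α x t := by
      rw [hβ, IccExtend_of_mem _ _ ht]
      rfl
    set w : ℝ → ℝ := fun t => clamp a t₀ c t (Real.exp (-A t) * β t) with hw
    have hwc : Continuous w := by
      simp only [hw, clamp]
      fun_prop
    refine nonneg_of_weighted_integral_nonpos (a₀ := a 0) (a₁ := a 1)
      (h := fun t => ∑ k ∈ Finset.Icc 2 n, a k t * w t ^ (k - 1))
      (H := fun t => ∑ k ∈ Finset.Icc 2 n, max (a k t) 0 * eta a t₀ c t ^ (k - 1))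
      (by fun_prop) (by fun_prop) (ha 0) (ha 1) (fun t ht => ?_) ?_ (fun t ht => ?_) hweight
    · refine ((hα x hx).2 t ht).congr_deriv ?_
      have hwt : w t = clamp a t₀ c t (Real.exp (-A t) * α x t) := by rw [hw, ← hβeq t ht]
      change -(Real.exp (A t) * _) = -(Real.exp (A t) * _ + _)
      rw [← hwt]
      have hk : superlinear n a t (w t)
          = (∑ k ∈ Finset.Icc 2 n, a k t * w t ^ (k - 1)) * w t := by
        rw [superlinear, Finset.sum_mul]
        refine Finset.sum_congr rfl fun k hk => ?_
        rw [mul_assoc, ← pow_succ, Nat.sub_add_cancel (by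
          have := (Finset.mem_Icc.1 hk).1
          omega)]
      -- The sign of `α x t` is not yet known. If it is nonnegative, truncation does nothing;
      -- otherwise `w t = 0` and the coefficient vanishes too, since `k - 1 ≥ 1`.
      have hmul : (∑ k ∈ Finset.Icc 2 n, a k t * w t ^ (k - 1)) * w t
          = (∑ k ∈ Finset.Icc 2 n, a k t * w t ^ (k - 1)) * (Real.exp (-A t) * α x t) := by
        rcases le_total 0 (Real.exp (-A t) * α x t) with h | h
        · rw [show w t = Real.exp (-A t) * α x t by
            rw [hwt, clamp, min_eq_left (hupη x hx t ht), max_eq_right h]]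
        · have hw0 : w t = 0 := by
            rw [hwt, clamp, max_eq_left ((min_le_left _ _).trans h)]
          have hs : ∑ k ∈ Finset.Icc 2 n, a k t * w t ^ (k - 1) = 0 :=
            Finset.sum_eq_zero fun k hk => by
              rw [hw0, zero_pow (by have := (Finset.mem_Icc.1 hk).1; omega), mul_zero]
          rw [hs, zero_mul, zero_mul]
      have he : Real.exp (A t) * Real.exp (-A t) = 1 := by
        rw [← Real.exp_add, add_neg_cancel, Real.exp_zero]
      rw [hk, hmul]
      linear_combination
        (-(∑ k ∈ Finset.Icc 2 n, a k t * w t ^ (k - 1)) * α x t) * he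
    · rw [(hα x hx).1]
      exact hx.1
    · refine Finset.sum_le_sum fun k _ => ?_
      have hw0 : 0 ≤ w t := clamp_nonneg _ _ _ _ _
      exact mul_le_mul (le_max_left _ _) (pow_le_pow_left₀ hw0 (clamp_le_eta (hη t ht) _) _)
        (pow_nonneg hw0 _) (le_max_right _ _)
  -- Since `A t₀ = 0`, the initial value of `y` is `x` itself, so a fixed point means `y(T) =
  -- y(t₀)`.
  obtain ⟨x, hx, hfix⟩ : ∃ x ∈ Icc 0 c, Function.IsFixedPt
      (fun x => Real.exp (-A T) * α x T) x := by
    refine exists_mem_Icc_isFixedPt_of_mapsTo (continuousOn_const.mul hαc) hc0 fun x hx =>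
      ⟨mul_nonneg (Real.exp_pos _).le (hlow x hx T hTT), (hupη x hx T hTT).trans ?_⟩
    have he : Real.exp (-A T) * Real.exp (A T) = 1 := by
      rw [← Real.exp_add, neg_add_cancel, Real.exp_zero]
    have h1 : c - forcing a t₀ T ≤ c * Real.exp (A T) := by
      have : c * (1 - Real.exp (A T)) ≤ forcing a t₀ T := hend
      linarith
    have h2 := mul_le_mul_of_nonneg_left h1 (Real.exp_pos (-A T)).le
    calc eta a t₀ c T ≤ Real.exp (-A T) * (c * Real.exp (A T)) := h2
      _ = c := by linear_combination c * he
  have hnn (t : ℝ) (ht : t ∈ Icc t₀ T) : 0 ≤ Real.exp (-A t) * α x t :=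
    mul_nonneg (Real.exp_pos _).le (hlow x hx t ht)
  refine ⟨fun t => Real.exp (-A t) * α x t, ⟨fun t ht => ?_, ?_⟩, hnn⟩
  · refine (((hAd t).neg.exp.hasDerivWithinAt).mul ((hα x hx).2 t ht)).congr_deriv ?_
    change Real.exp (-A t) * (-a 1 t) * α x t + Real.exp (-A t) * (-(Real.exp (A t) *
      (a 0 t + superlinear n a t (clamp a t₀ c t (Real.exp (-A t) * α x t))))) = _
    have he : Real.exp (-A t) * Real.exp (A t) = 1 := by
      rw [← Real.exp_add, neg_add_cancel, Real.exp_zero]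
    rw [sum_eq_superlinear hn, clamp, min_eq_left (hupη x hx t ht), max_eq_right (hnn t ht)]
    linear_combination
      (-(a 0 t + superlinear n a t (Real.exp (-A t) * α x t))) * he
  · change Real.exp (-A t₀) * α x t₀ = Real.exp (-A T) * α x T
    rw [show Real.exp (-A T) * α x T = x from hfix, hA0, (hα x hx).1]
    simp

/-! ### From coefficients on the interval to coefficients on the line. -/

section Congruence

variable {a b : ℕ → ℝ → ℝ} {n : ℕ} {t₀ T c : ℝ}

theorem integral_congr_Icc {f g : ℝ → ℝ} (h : ∀ t ∈ Icc t₀ T, f t = g t) {t : ℝ}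
    (ht : t ∈ Icc t₀ T) : ∫ s in t₀..t, f s = ∫ s in t₀..t, g s :=
  integral_congr fun s hs => by
    rw [uIcc_of_le ht.1] at hs
    exact h s ⟨hs.1, hs.2.trans ht.2⟩

theorem forcing_congr (h0 : EqOn (a 0) (b 0) (Icc t₀ T)) (h1 : EqOn (a 1) (b 1) (Icc t₀ T))
    {t : ℝ} (ht : t ∈ Icc t₀ T) : forcing a t₀ t = forcing b t₀ t :=
  integral_congr_Icc (fun τ hτ => by rw [integral_congr_Icc h1 hτ, h0 hτ]) ht

theorem eta_congr (h0 : EqOn (a 0) (b 0) (Icc t₀ T)) (h1 : EqOn (a 1) (b 1) (Icc t₀ T))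
    {t : ℝ} (ht : t ∈ Icc t₀ T) : eta a t₀ c t = eta b t₀ c t := by
  rw [eta, eta, integral_congr_Icc h1 ht, forcing_congr h0 h1 ht]

end Congruence

/-- Existence of a nonnegative closed solution. -/
theorem hasNonnegClosedSolution {n : ℕ} (hn : 2 ≤ n) {t₀ T : ℝ} (hT : t₀ < T)
    {a : ℕ → ℝ → ℝ} (ha : ∀ k ≤ n, ContinuousOn (a k) (Icc t₀ T)) {c : ℝ}
    (hc : ∀ t ∈ Icc t₀ T, forcing a t₀ t ≤ c)
    (hdom : DominationCond n a t₀ T c) (hweight : WeightedIntegralCond n a t₀ T c)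
    (hend : EndpointCond a t₀ T c) : HasNonnegClosedSolution n a t₀ T := by
  -- Constant extension past the endpoints; indices above `n` carry no continuity assumption and are
  -- set to `0`.
  set b : ℕ → ℝ → ℝ := fun k =>
    if k ≤ n then IccExtend hT.le ((Icc t₀ T).domRestrict (a k)) else 0 with hb
  have hbc (k : ℕ) : Continuous (b k) := by
    by_cases hk : k ≤ n
    · simp only [hb, if_pos hk]
      exact (continuousOn_iff_continuous_domRestrict.1 (ha k hk)).Icc_extend'
    · simp only [hb, if_neg hk]
      exact continuous_zero
  have hab (k : ℕ) (hk : k ≤ n) : EqOn (b k) (a k) (Icc t₀ T) := fun t ht => by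
    simp only [hb, if_pos hk]
    rw [IccExtend_of_mem _ _ ht]
    rfl
  have h0 := hab 0 (by omega)
  have h1 := hab 1 (by omega)
  have hTT : T ∈ Icc t₀ T := right_mem_Icc.2 hT.le
  obtain ⟨y, ⟨hy, hcl⟩, hnn⟩ : HasNonnegClosedSolution n b t₀ T := by
    refine hasNonnegClosedSolution_of_continuous hn hT hbc (c := c) (fun t ht => ?_)
      (fun t ht => ?_) (fun t ht => ?_) ?_
    · rw [forcing_congr h0 h1 ht]
      exact hc t ht
    · rw [hab 2 hn ht, higherSum, eta_congr h0 h1 ht]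
      refine le_trans (le_of_eq ?_) (hdom t ht)
      exact Finset.sum_congr rfl fun k hk => by rw [hab k (Finset.mem_Icc.1 hk).2 ht]
    · refine le_trans (le_of_eq ?_) (hweight t ht)
      refine integral_congr_Icc (fun τ hτ => ?_) ht
      rw [h0 hτ]
      congr 2
      refine integral_congr_Icc (fun s hs => ?_) hτ
      rw [h1 hs, eta_congr h0 h1 hs]
      congr 1
      exact Finset.sum_congr rfl fun k hk => by rw [hab k (Finset.mem_Icc.1 hk).2 hs]
    · rw [EndpointCond, integral_congr_Icc h1 hTT, forcing_congr h0 h1 hTT]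
      exact hend
  refine ⟨y, ⟨fun t ht => (hy t ht).congr_deriv ?_, hcl⟩, hnn⟩
  exact congrArg Neg.neg (Finset.sum_congr rfl fun k hk => by
    rw [hab k (by have := Finset.mem_range.1 hk; omega) ht])

/-! ### Replacing `a₂`, and the thresholds. -/

section SetSecond

variable (a : ℕ → ℝ → ℝ) (q : ℝ → ℝ)

theorem setSecond_of_ne {k : ℕ} (hk : k ≠ 2) : setSecond a q k = a k :=
  Function.update_of_ne hk _ _

theorem setSecond_two : setSecond a q 2 = q := Function.update_self _ _ _

/-- Only the coefficients with index `0` and `1` enter, so `η_c` and the thresholds are fixed before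
`a₂` is chosen. -/
theorem forcing_setSecond (t₀ t : ℝ) : forcing (setSecond a q) t₀ t = forcing a t₀ t := by
  simp only [forcing, setSecond_of_ne a q (show 0 ≠ 2 by decide),
    setSecond_of_ne a q (show 1 ≠ 2 by decide)]

theorem eta_setSecond (t₀ c t : ℝ) : eta (setSecond a q) t₀ c t = eta a t₀ c t := by
  simp only [eta, forcing_setSecond, setSecond_of_ne a q (show 1 ≠ 2 by decide)]

theorem higherSum_setSecond (n : ℕ) (t₀ c t : ℝ) :
    higherSum n (setSecond a q) t₀ c t = higherSum n a t₀ c t := by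
  unfold higherSum
  refine Finset.sum_congr rfl fun k hk => ?_
  rw [setSecond_of_ne a q (by have := (Finset.mem_Icc.1 hk).1; omega), eta_setSecond]

theorem endpointCond_setSecond {t₀ T c : ℝ} :
    EndpointCond (setSecond a q) t₀ T c ↔ EndpointCond a t₀ T c := by
  simp only [EndpointCond, forcing_setSecond, setSecond_of_ne a q (show 1 ≠ 2 by decide)]

variable {a q}

theorem hasNonnegClosedSolution_setSecond {n : ℕ} (hn : 2 ≤ n) {t₀ T : ℝ} (hT : t₀ < T)
    (ha : ∀ k ≤ n, ContinuousOn (a k) (Icc t₀ T)) {c : ℝ}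
    (hc : ∀ t ∈ Icc t₀ T, forcing a t₀ t ≤ c) (hq : ContinuousOn q (Icc t₀ T))
    (hdom : DominationCond n (setSecond a q) t₀ T c)
    (hweight : WeightedIntegralCond n (setSecond a q) t₀ T c)
    (hend : EndpointCond a t₀ T c) : HasNonnegClosedSolution n (setSecond a q) t₀ T := by
  refine hasNonnegClosedSolution hn hT (fun k hk => ?_)
    (fun t ht => (forcing_setSecond a q t₀ t).trans_le (hc t ht)) hdom hweight
    ((endpointCond_setSecond a q).2 hend)
  rcases eq_or_ne k 2 with rfl | h
  · rwa [setSecond_two]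
  · rw [setSecond_of_ne a q h]
    exact ha k hk

end SetSecond

theorem continuousOn_higherSum {n : ℕ} (hn : 2 ≤ n) {t₀ T : ℝ} (hT : t₀ < T)
    {a : ℕ → ℝ → ℝ} (ha : ∀ k ≤ n, ContinuousOn (a k) (Icc t₀ T)) (c : ℝ) :
    ContinuousOn (higherSum n a t₀ c) (Icc t₀ T) := by
  have hint {f : ℝ → ℝ} (hf : ContinuousOn f (Icc t₀ T)) :
      ContinuousOn (fun t => ∫ s in t₀..t, f s) (Icc t₀ T) := by
    have := continuousOn_primitive_interval (a := t₀) (b := T)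
      (μ := MeasureTheory.volume) (f := f)
      (by rw [uIcc_of_le hT.le]; exact hf.integrableOn_Icc)
    rwa [uIcc_of_le hT.le] at this
  have h1 := hint (ha 1 (by omega))
  have hF : ContinuousOn (forcing a t₀) (Icc t₀ T) :=
    hint ((Real.continuous_exp.comp_continuousOn h1).mul (ha 0 (by omega)))
  have hη : ContinuousOn (eta a t₀ c) (Icc t₀ T) :=
    (Real.continuous_exp.comp_continuousOn h1.neg).mul (continuousOn_const.sub hF)
  exact continuousOn_finsetSum _ fun k hk =>
    (ha k (Finset.mem_Icc.1 hk).2).abs.mul (hη.pow _)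

/-- Compactness makes the supremum an attained maximum, so the thresholds are genuine maxima. -/
theorem isGreatest_sSup_image {f : ℝ → ℝ} {t₀ T : ℝ} (hT : t₀ ≤ T)
    (hf : ContinuousOn f (Icc t₀ T)) : IsGreatest (f '' Icc t₀ T) (sSup (f '' Icc t₀ T)) :=
  (isCompact_Icc.image_of_continuousOn hf).isGreatest_sSup ((nonempty_Icc.2 hT).image f)

end PolyODE

theorem theorem5p4 (n : ℕ) (hn : 2 ≤ n) (t₀ T : ℝ) (hT : t₀ < T) (a : ℕ → ℝ → ℝ)
    (ha : ∀ k ≤ n, ContinuousOn (a k) (Icc t₀ T)) (c : ℝ)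
    (hc : ∀ t ∈ Icc t₀ T, PolyODE.forcing a t₀ t ≤ c) :
    -- existence of a nonnegative closed solution
    ((∀ t ∈ Icc t₀ T, 0 < a 2 t) →
      PolyODE.DominationCond n a t₀ T c →
      PolyODE.WeightedIntegralCond n a t₀ T c →
      PolyODE.EndpointCond a t₀ T c →
      PolyODE.HasNonnegClosedSolution n a t₀ T) ∧
    -- explicit threshold for `a₂ = l * p`, `p > 0`
    (∀ p : ℝ → ℝ, ContinuousOn p (Icc t₀ T) → (∀ t ∈ Icc t₀ T, 0 < p t) →
      IsGreatest ((fun t => PolyODE.higherSum n a t₀ c t / p t) '' Icc t₀ T)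
        (PolyODE.mulThreshold n a t₀ T c p) ∧
      ∀ l : ℝ, PolyODE.mulThreshold n a t₀ T c p ≤ l →
        PolyODE.DominationCond n (PolyODE.setSecond a (fun t => l * p t)) t₀ T c ∧
        (0 < l →
          PolyODE.WeightedIntegralCond n (PolyODE.setSecond a (fun t => l * p t)) t₀ T c →
          PolyODE.EndpointCond a t₀ T c →
          PolyODE.HasNonnegClosedSolution n (PolyODE.setSecond a (fun t => l * p t)) t₀ T)) ∧
    -- explicit threshold for `a₂ = l + p`
    (∀ p : ℝ → ℝ, ContinuousOn p (Icc t₀ T) →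
      IsGreatest ((fun t => PolyODE.higherSum n a t₀ c t - p t) '' Icc t₀ T)
        (PolyODE.addThreshold n a t₀ T c p) ∧
      ∀ l : ℝ, PolyODE.addThreshold n a t₀ T c p ≤ l →
        PolyODE.DominationCond n (PolyODE.setSecond a (fun t => l + p t)) t₀ T c ∧
        ((∀ t ∈ Icc t₀ T, 0 < l + p t) →
          PolyODE.WeightedIntegralCond n (PolyODE.setSecond a (fun t => l + p t)) t₀ T c →
          PolyODE.EndpointCond a t₀ T c →
          PolyODE.HasNonnegClosedSolution n (PolyODE.setSecond a (fun t => l + p t)) t₀ T)) := by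
  have hS := PolyODE.continuousOn_higherSum hn hT ha c
  refine ⟨fun _ => PolyODE.hasNonnegClosedSolution hn hT ha hc, fun p hp hpos => ?_,
    fun p hp => ?_⟩
  · have hmax := PolyODE.isGreatest_sSup_image hT.le (hS.div hp fun t ht => (hpos t ht).ne')
    refine ⟨hmax, fun l hl => ?_⟩
    have hdom : PolyODE.DominationCond n (PolyODE.setSecond a (fun t => l * p t)) t₀ T c := by
      intro t ht
      rw [PolyODE.higherSum_setSecond, PolyODE.setSecond_two]
      exact (div_le_iff₀ (hpos t ht)).1 ((hmax.2 (mem_image_of_mem _ ht)).trans hl)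
    exact ⟨hdom, fun _ => PolyODE.hasNonnegClosedSolution_setSecond hn hT ha hc
      (continuousOn_const.mul hp) hdom⟩
  · have hmax := PolyODE.isGreatest_sSup_image hT.le (hS.sub hp)
    refine ⟨hmax, fun l hl => ?_⟩
    have hdom : PolyODE.DominationCond n (PolyODE.setSecond a (fun t => l + p t)) t₀ T c := by
      intro t ht
      rw [PolyODE.higherSum_setSecond, PolyODE.setSecond_two]
      exact sub_le_iff_le_add.1 ((hmax.2 (mem_image_of_mem _ ht)).trans hl)
    exact ⟨hdom, fun _ => PolyODE.hasNonnegClosedSolution_setSecond hn hT ha hc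
      (continuousOn_const.add hp) hdom⟩
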